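/- **Setting.** For $\lambda>0$ and $u\in\mathbb R^m$ let $\mathrm{Softmax}_\lambda(u)_i=e^{\lambda u_i}/\sum_{j}e^{\lambda u_j}$, applied column by column to matrices. An $H$-head attention layer with inverse temperature $\lambda$ is a map $$\mathrm{Attn}(Z)=\sum_{h=1}^H W_V^{(h)}Z\,\mathrm{Softmax}_\lambda\big((W_K^{(h)}Z)^\top W_Q^{(h)}Z\big),$$ with $W_K^{(h)},W_Q^{(h)}\in\mathbb R^{d_h\times d_{\rm in}}$ and $W_V^{(h)}\in\mathbb R^{d_{\rm out}\times d_{\rm in}}$; write $W_{KQ}^{(h)}=(W_K^{(h)})^\top W_Q^{(h)}$. The class $\mathcal T(H,W,K,C_{KQ},C_V)$ with inverse temperature $\lambda$ consists of the maps $$\tau=T\circ\mathrm{Attn}^{(K)}\circ\cdots\circ\mathrm{Attn}^{(1)}\circ P,$$ where each $\mathrm{Attn}^{(j)}$ is an $H$-head attention layer with inverse temperature $\lambda$ mapping token dimension $d_j$ to token dimension $d_{j+1}$, $P(X)=\begin{bmatrix}X&0\\ I_n&0\\ 0&1\end{bmatrix}$ for an input $X$ with $n$ tokens, and $T$ deletes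 the last token. Here $W$ is the maximum of all token dimensions $d_1,\dots,d_{K+1}$ and all head dimensions $d_h$, while $C_V>0$ and $C_{KQ}>0$ are the maxima over all layers and heads of $\|W_V\|_F$ and $\|W_{KQ}\|_F$. A scalar $t$ is regarded as a one-token input of dimension $1$ ($n=1$), and the output is also one scalar token. **Proposition (Approximation of $\exp(-t/2)$).** There are an absolute constant $c>0$ and a fixed real polynomial $p$ such that the following holds. For every $\epsilon\in(0,1)$ and every $C_X>0$ there is a Transformer $f_\alpha\in\mathcal T(H,W,K,C_{KQ},C_V)$, for some $H,W,K,C_{KQ},C_V$ and some inverse temperature $\lambda>0$, with $$|f_\alpha(t)-\exp(-t/2)|\le\epsilon\qquad\text{for all }0\le t\le C_X .$$ Moreover, if $C_X\ge1$, then with $\delta:=\max\{1/\epsilon,2\}$ the parameters of this $f_\alpha$ satisfy $$H\le c\ln\delta,\qquad W\le c\ln\delta,\qquad K\le c\ln^2\delta,$$ $$C_V\le\exp(c\ln^2\delta)\cdot c\sqrt{\ln\delta},\qquad C_{KQ}\le c\sqrt{\ln^2\delta\,(\ln^2\delta+\ln C_X)},$$ $$\lambda\le\exp(c\ln^4\delta)\cdot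 c\,(\ln\delta)^{p(\ln\delta)}\cdot\ln\max\{C_X,2\}.$$ -/

import Mathlib

open Matrix

noncomputable section

/-- Frobenius norm of a real matrix. -/
def frobeniusNorm {m n : ℕ} (A : Matrix (Fin m) (Fin n) ℝ) : ℝ :=
  @norm _ (Matrix.frobeniusNormedAddCommGroup).toNorm A

/-- Softmax with inverse temperature `lam` of a vector. -/
def softmaxVec (lam : ℝ) {d : ℕ} (u : Fin d → ℝ) : Fin d → ℝ :=
  fun i => Real.exp (lam * u i) / ∑ j, Real.exp (lam * u j)

/-- Column-wise softmax with inverse temperature `lam` of a matrix. -/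
def softmaxCols (lam : ℝ) {d n : ℕ} (X : Matrix (Fin d) (Fin n) ℝ) : Matrix (Fin d) (Fin n) ℝ :=
  Matrix.of fun i k => softmaxVec lam (fun l => X l k) i

/-- The weights of one attention head, with its own key/query dimension `dh`. -/
structure AttnHead (din dout : ℕ) where
  dh : ℕ
  WK : Matrix (Fin dh) (Fin din) ℝ
  WQ : Matrix (Fin dh) (Fin din) ℝ
  WV : Matrix (Fin dout) (Fin din) ℝ

/-- `W_KQ = W_Kᵀ W_Q`. -/
def AttnHead.WKQ {din dout : ℕ} (h : AttnHead din dout) : Matrix (Fin din) (Fin din) ℝ :=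
  h.WKᵀ * h.WQ

/-- A multi-head self-attention layer acting on a sequence of `n` tokens. -/
def attnLayer (lam : ℝ) {H din dout n : ℕ} (L : Fin H → AttnHead din dout)
    (Z : Matrix (Fin din) (Fin n) ℝ) : Matrix (Fin dout) (Fin n) ℝ :=
  ∑ h, (L h).WV * Z * softmaxCols lam (((L h).WK * Z)ᵀ * ((L h).WQ * Z))

/-- The weights of a stack of `K` consecutive `H`-head attention layers with input token dimension
`a` and output token dimension `b`; the first layer comes first. -/
inductive AttnStack (H : ℕ) : ℕ → ℕ → ℕ → Type
  | nil (a : ℕ) : AttnStack H 0 a a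
  | cons {K a b c : ℕ} (first : Fin H → AttnHead a b) (rest : AttnStack H K b c) :
      AttnStack H (K + 1) a c

namespace AttnStack

/-- The composition `Attn⁽ᴷ⁾ ∘ ⋯ ∘ Attn⁽¹⁾`. -/
def apply (lam : ℝ) {H n : ℕ} : {K a b : ℕ} → AttnStack H K a b →
    Matrix (Fin a) (Fin n) ℝ → Matrix (Fin b) (Fin n) ℝ
  | _, _, _, nil _, Z => Z
  | _, _, _, cons first rest, Z => rest.apply lam (attnLayer lam first Z)

/-- All token dimensions `d_1, …, d_{K+1}` and all head dimensions. -/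
def widths {H : ℕ} : {K a b : ℕ} → AttnStack H K a b → Set ℕ
  | _, _, _, nil a => {a}
  | _, a, _, cons first rest => {a} ∪ Set.range (fun h => (first h).dh) ∪ rest.widths

/-- The Frobenius norms of all value matrices. -/
def vNorms {H : ℕ} : {K a b : ℕ} → AttnStack H K a b → Set ℝ
  | _, _, _, nil _ => ∅
  | _, _, _, cons first rest => Set.range (fun h => frobeniusNorm (first h).WV) ∪ rest.vNorms

/-- The Frobenius norms of all matrices `W_KQ`. -/
def kqNorms {H : ℕ} : {K a b : ℕ} → AttnStack H K a b → Set ℝ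
  | _, _, _, nil _ => ∅
  | _, _, _, cons first rest => Set.range (fun h => frobeniusNorm (first h).WKQ) ∪ rest.kqNorms

end AttnStack

/-- The preprocessing layer: append a zero token and the one-hot positional encoding,
`P(X) = [X 0; I_{n+1}]`. -/
def preprocess {d n : ℕ} (X : Matrix (Fin d) (Fin n) ℝ) :
    Matrix (Fin (d + (n + 1))) (Fin (n + 1)) ℝ :=
  Matrix.of fun i k =>
    Fin.addCases (motive := fun _ => ℝ)
      (fun r => Fin.snoc (α := fun _ => ℝ) (X r) 0 k)
      (fun q => (1 : Matrix (Fin (n + 1)) (Fin (n + 1)) ℝ) q k) i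

/-- The truncation layer: delete the last token. -/
def truncateLast {d n : ℕ} (Y : Matrix (Fin d) (Fin (n + 1)) ℝ) : Matrix (Fin d) (Fin n) ℝ :=
  Y.submatrix id Fin.castSucc

/-- The class `𝒯(H, W, K, C_KQ, C_V)` of attention-only Transformers
`T ∘ Attn⁽ᴷ⁾ ∘ ⋯ ∘ Attn⁽¹⁾ ∘ P` from `ℝ^{d × n}` to `ℝ^{dout × n}`, all of whose layers have inverse
temperature `lam`. -/
def transformerClass (d n dout H W K : ℕ) (CKQ CV lam : ℝ) :
    Set (Matrix (Fin d) (Fin n) ℝ → Matrix (Fin dout) (Fin n) ℝ) :=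
  {τ | 0 < CKQ ∧ 0 < CV ∧ 0 < lam ∧ ∃ S : AttnStack H K (d + (n + 1)) dout,
    IsGreatest S.widths W ∧ IsGreatest S.kqNorms CKQ ∧ IsGreatest S.vNorms CV ∧
    ∀ X, τ X = truncateLast (S.apply lam (preprocess X))}

end

/-!
A single attention head computes logistic functions exactly: on the input tokens `(t, 1, 0)` and
`(0, 0, 1)` its scores for the first token can be made `0` and `a * t + b`, so that the softmax
weight of the first token is `1 / (1 + exp (a * t + b))`. With `b = -log ε` and value `ε⁻¹` the head
outputs `1 / (ε + exp (a * t))`, which for `a * t ≥ 0` differs from `exp (-(a * t))` by at most `ε`.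
Neither the head nor the error depends on the length of the interval of `t`.
-/

theorem frobeniusNorm_eq_sqrt {m n : ℕ} (A : Matrix (Fin m) (Fin n) ℝ) :
    frobeniusNorm A = √(∑ i, ∑ j, A i j ^ 2) := by
  rw [frobeniusNorm, Matrix.frobenius_norm_def, Real.sqrt_eq_rpow]
  simp only [Real.norm_eq_abs, Real.rpow_two, sq_abs]

section OneHead

variable {d n dout : ℕ}

/-- The Transformer with a single attention layer, consisting of the single head `h`. -/
noncomputable def oneHeadTransformer (lam : ℝ) (h : AttnHead (d + (n + 1)) dout)
    (X : Matrix (Fin d) (Fin n) ℝ) : Matrix (Fin dout) (Fin n) ℝ :=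
  truncateLast (attnLayer lam (fun _ : Fin 1 => h) (preprocess X))

theorem oneHeadTransformer_mem_transformerClass {lam : ℝ} (hlam : 0 < lam)
    (h : AttnHead (d + (n + 1)) dout) (hKQ : 0 < frobeniusNorm h.WKQ)
    (hV : 0 < frobeniusNorm h.WV) :
    oneHeadTransformer lam h ∈ transformerClass d n dout 1 (max (max (d + (n + 1)) h.dh) dout) 1
      (frobeniusNorm h.WKQ) (frobeniusNorm h.WV) lam := by
  refine ⟨hKQ, hV, hlam, .cons (fun _ => h) (.nil dout), ?_, ?_, ?_, fun _ => rfl⟩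
  · simpa only [AttnStack.widths, Set.range_const] using
      (isGreatest_singleton.union isGreatest_singleton).union isGreatest_singleton
  · simp only [AttnStack.kqNorms, Set.range_const, Set.union_empty, isGreatest_singleton]
  · simp only [AttnStack.vNorms, Set.range_const, Set.union_empty, isGreatest_singleton]

end OneHead

section LogisticHead

/-- The head which, at inverse temperature `lam`, sends a scalar token `t` to the logistic function
`v / (1 + exp (lam * (a * t + b)))`. The three coordinates of a preprocessed token are the input,
the indicator of the input token and the indicator of the appended token: the key sees only the last
one, the value only the second one. -/
noncomputable def logisticHead (a b v : ℝ) : AttnHead (1 + (1 + 1)) 1 where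
  dh := 1
  WK := !![0, 0, 1]
  WQ := !![a, b, 0]
  WV := !![0, v, 0]

theorem preprocess_scalar (t : ℝ) :
    preprocess !![t] = (!![t, 0; 1, 0; 0, 1] : Matrix (Fin 3) (Fin 2) ℝ) := by
  ext i k
  fin_cases i <;> fin_cases k <;> rfl

theorem oneHeadTransformer_logisticHead (lam a b v t : ℝ) :
    oneHeadTransformer lam (logisticHead a b v) !![t] 0 0 =
      v / (1 + Real.exp (lam * (a * t + b))) := by
  have hK : (!![0, 0, 1] : Matrix (Fin 1) (Fin 3) ℝ) * !![t, 0; 1, 0; 0, 1] = !![0, 1] := by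
    simp
  have hQ : (!![a, b, 0] : Matrix (Fin 1) (Fin 3) ℝ) * !![t, 0; 1, 0; 0, 1] =
      !![a * t + b, 0] := by
    simp
  have hV : (!![0, v, 0] : Matrix (Fin 1) (Fin 3) ℝ) * !![t, 0; 1, 0; 0, 1] = !![v, 0] := by
    simp
  rw [oneHeadTransformer, attnLayer, Fin.sum_univ_one, preprocess_scalar]
  change ((!![0, v, 0] : Matrix (Fin 1) (Fin 3) ℝ) * !![t, 0; 1, 0; 0, 1] *
    softmaxCols lam (((!![0, 0, 1] : Matrix (Fin 1) (Fin 3) ℝ) * !![t, 0; 1, 0; 0, 1])ᵀ *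
      ((!![a, b, 0] : Matrix (Fin 1) (Fin 3) ℝ) * !![t, 0; 1, 0; 0, 1]))) 0 0 = _
  rw [hK, hQ, hV]
  simp [softmaxCols, softmaxVec, Matrix.mul_apply, div_eq_mul_inv]

theorem logisticHead_WKQ (a b v : ℝ) :
    (logisticHead a b v).WKQ = (!![0, 0, 0; 0, 0, 0; a, b, 0] : Matrix (Fin 3) (Fin 3) ℝ) := by
  change (!![0, 0, 1] : Matrix (Fin 1) (Fin 3) ℝ)ᵀ * !![a, b, 0] = _
  ext i j
  fin_cases i <;> fin_cases j <;> simp [Matrix.mul_apply]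

theorem frobeniusNorm_logisticHead_WKQ (a b v : ℝ) :
    frobeniusNorm (logisticHead a b v).WKQ = √(a ^ 2 + b ^ 2) := by
  rw [frobeniusNorm_eq_sqrt, logisticHead_WKQ]
  simp [Fin.sum_univ_succ]

theorem frobeniusNorm_logisticHead_WV (a b v : ℝ) :
    frobeniusNorm (logisticHead a b v).WV = |v| := by
  rw [frobeniusNorm_eq_sqrt]
  simp [logisticHead, Fin.sum_univ_succ, Real.sqrt_sq_eq_abs]

end LogisticHead

section Estimates

theorem abs_one_div_add_sub_one_div_le {ε x : ℝ} (hε : 0 ≤ ε) (hx : 1 ≤ x) :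
    |1 / (ε + x) - 1 / x| ≤ ε := by
  have hx0 : 0 < x := one_pos.trans_le hx
  have hdiff : 1 / (ε + x) - 1 / x = -(ε / ((ε + x) * x)) := by
    rw [div_sub_div _ _ (by positivity) hx0.ne']
    ring
  rw [hdiff, abs_neg, abs_of_nonneg (by positivity)]
  exact div_le_self hε (one_le_mul_of_one_le_of_one_le (by linarith) hx)

theorem inv_div_one_add_exp_sub_log {ε : ℝ} (hε : 0 < ε) (x : ℝ) :
    ε⁻¹ / (1 + Real.exp (x - Real.log ε)) = 1 / (ε + Real.exp x) := by
  rw [Real.exp_sub, Real.exp_log hε]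
  field_simp

theorem half_le_log_max_two (x : ℝ) : 1 / 2 ≤ Real.log (max x 2) :=
  calc (1 / 2 : ℝ) ≤ Real.log 2 := by linarith [Real.log_two_gt_d9]
    _ ≤ Real.log (max x 2) := Real.log_le_log two_pos (le_max_right x 2)

theorem exp_le_exp_sq_mul_sqrt {L : ℝ} (hL : 1 / 2 ≤ L) :
    Real.exp L ≤ Real.exp (6 * L ^ 2) * (6 * √L) := by
  have hexp : Real.exp L ≤ Real.exp (6 * L ^ 2) := Real.exp_le_exp.2 (by nlinarith)
  have hsqrt : 1 / 2 ≤ √L := Real.le_sqrt_of_sq_le (by linarith)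
  exact hexp.trans (le_mul_of_one_le_right (Real.exp_nonneg _) (by linarith))

theorem sqrt_half_sq_add_sq_le {l L M : ℝ} (hl : l ^ 2 ≤ L ^ 2) (hL : 1 / 2 ≤ L) (hM : 0 ≤ M) :
    √((1 / 2) ^ 2 + l ^ 2) ≤ 6 * √(L ^ 2 * (L ^ 2 + M)) := by
  have hL2 : 1 / 4 ≤ L ^ 2 := by nlinarith
  have hLM : 0 ≤ L ^ 2 * M := by positivity
  rw [Real.sqrt_le_left (by positivity), mul_pow, Real.sq_sqrt (by positivity)]
  nlinarith

theorem sq_log_le_sq_log_max_one_div {ε : ℝ} (hε : 0 < ε) (hε1 : ε ≤ 1) (x : ℝ) :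
    Real.log ε ^ 2 ≤ Real.log (max (1 / ε) x) ^ 2 := by
  rw [← neg_sq, ← Real.log_inv, ← one_div]
  exact pow_le_pow_left₀ (Real.log_nonneg (one_le_one_div hε hε1))
    (Real.log_le_log (by positivity) (le_max_left _ _)) 2

end Estimates

theorem mainTheorem8_general {a ε : ℝ} (ha : 0 < a) (hε : 0 < ε) :
    ∃ f ∈ transformerClass 1 1 1 1 3 1 √(a ^ 2 + Real.log ε ^ 2) ε⁻¹ 1,
      ∀ t : ℝ, 0 ≤ t → |f !![t] 0 0 - Real.exp (-(a * t))| ≤ ε := by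
  let h := logisticHead a (-Real.log ε) ε⁻¹
  have hKQ : frobeniusNorm h.WKQ = √(a ^ 2 + Real.log ε ^ 2) := by
    rw [frobeniusNorm_logisticHead_WKQ, neg_sq]
  have hV : frobeniusNorm h.WV = ε⁻¹ := by
    rw [frobeniusNorm_logisticHead_WV, abs_of_pos (inv_pos.2 hε)]
  refine ⟨oneHeadTransformer 1 h, ?_, fun t ht => ?_⟩
  · rw [← hKQ, ← hV]
    exact oneHeadTransformer_mem_transformerClass one_pos h (by rw [hKQ]; positivity)
      (by rw [hV]; positivity)
  · rw [oneHeadTransformer_logisticHead, one_mul, ← sub_eq_add_neg,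
      inv_div_one_add_exp_sub_log hε, Real.exp_neg, ← one_div]
    exact abs_one_div_add_sub_one_div_le hε.le (Real.one_le_exp (by positivity))

theorem mainTheorem8 :
    ∃ (c : ℝ) (polylog : Polynomial ℝ), 0 < c ∧
      ∀ ε : ℝ, 0 < ε → ε < 1 → ∀ CX : ℝ, 0 < CX →
        ∃ (H W K : ℕ) (CKQ CV lam : ℝ), ∃ f ∈ transformerClass 1 1 1 H W K CKQ CV lam,
          (∀ t : ℝ, 0 ≤ t → t ≤ CX → |f !![t] 0 0 - Real.exp (-t / 2)| ≤ ε) ∧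
          (1 ≤ CX → ∀ δ : ℝ, δ = max (1 / ε) 2 →
            (H : ℝ) ≤ c * Real.log δ ∧
            (W : ℝ) ≤ c * Real.log δ ∧
            (K : ℝ) ≤ c * Real.log δ ^ 2 ∧
            CV ≤ Real.exp (c * Real.log δ ^ 2) * (c * √(Real.log δ)) ∧
            CKQ ≤ c * √(Real.log δ ^ 2 * (Real.log δ ^ 2 + Real.log CX)) ∧
            lam ≤ Real.exp (c * Real.log δ ^ 4) *
              (c * (Real.log δ ^ (polylog.eval (Real.log δ)) * Real.log (max CX 2)))) := by
  refine ⟨6, 0, by norm_num, fun ε hε hε1 CX _ => ?_⟩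
  obtain ⟨f, hf, hfε⟩ := mainTheorem8_general one_half_pos hε
  refine ⟨1, 3, 1, _, _, 1, f, hf, fun t ht _ => ?_, ?_⟩
  · rw [neg_div, div_eq_inv_mul, ← one_div]
    exact hfε t ht
  · rintro hCX δ rfl
    have hδ : 0 < max (1 / ε) 2 := two_pos.trans_le (le_max_right _ _)
    have hL := half_le_log_max_two (1 / ε)
    have hCV := exp_le_exp_sq_mul_sqrt hL
    have hCKQ := sqrt_half_sq_add_sq_le (sq_log_le_sq_log_max_one_div hε hε1.le 2) hL
      (Real.log_nonneg hCX)
    refine ⟨by push_cast; linarith, by push_cast; linarith, by push_cast; nlinarith, ?_, hCKQ, ?_⟩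
    · rw [Real.exp_log hδ] at hCV
      exact ((one_div ε).symm.trans_le (le_max_left _ _)).trans hCV
    · rw [Polynomial.eval_zero, Real.rpow_zero, one_mul]
      exact one_le_mul_of_one_le_of_one_le (Real.one_le_exp (by positivity))
        (by linarith [half_le_log_max_two CX])
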